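/- For a finite simple connected graph $G=(V,E)$ with at least two vertices, let $D_G=(d_G(v,w))_{v,w\in V}$ be its distance matrix, where $d_G(v,w)$ is the length of a shortest path between $v$ and $w$, and let $$\mathrm{QEC}(G)=\max\{\langle f,D_Gf\rangle : f\in\mathbb{R}^V,\ \langle f,f\rangle=1,\ \langle e,f\rangle=0\}$$ be its quadratic embedding constant, where $e$ is the all-ones vector and $\langle\cdot,\cdot\rangle$ is the standard inner product. Let $P_n$ be the path graph on $n$ vertices and $K_{1,n-1}$ the star graph on $n$ vertices. **Theorem.** Let $T_n$ be a tree on $n\ge 4$ vertices. Then $$\mathrm{QEC}(P_n)\le \mathrm{QEC}(T_n)\le \mathrm{QEC}(K_{1,n-1})=-\frac{2}{n}.$$ Moreover, $\mathrm{QEC}(P_n)=\mathrm{QEC}(T_n)$ if and only if $T_n$ is isomorphic to $P_n$, and $\mathrm{QEC}(T_n)=\mathrm{QEC}(K_{1,n-1})$ if and only if $T_n$ is isomorphic to $K_{1,n-1}$. -/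

import Mathlib

namespace SimpleGraph

/-- The distance matrix of a graph: the entry at `(v, w)` is the graph distance of `v` and `w`,
as a real number. -/
noncomputable def distanceMatrix {V : Type*} (G : SimpleGraph V) : Matrix V V ℝ :=
  Matrix.of fun v w => (G.dist v w : ℝ)

/-- The values `⟨f, D f⟩` of the quadratic form of the distance matrix, for `f` running over the
unit vectors (in the Euclidean norm) orthogonal to the constant function `1`. -/
def qecValues {V : Type*} [Fintype V] (G : SimpleGraph V) : Set ℝ :=
  {q | ∃ f : V → ℝ, f ⬝ᵥ f = 1 ∧ (1 : V → ℝ) ⬝ᵥ f = 0 ∧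
    q = f ⬝ᵥ Matrix.mulVec G.distanceMatrix f}

/-- The quadratic embedding constant of a graph. The supremum is a maximum when the
graph has at least two vertices, see `isGreatest_qec`. -/
noncomputable def qec {V : Type*} [Fintype V] (G : SimpleGraph V) : ℝ :=
  sSup G.qecValues

theorem isGreatest_qec {V : Type*} [Fintype V] [Nontrivial V] (G : SimpleGraph V) :
    IsGreatest G.qecValues G.qec := by
  classical
  have himg : G.qecValues = (fun f : V → ℝ => f ⬝ᵥ Matrix.mulVec G.distanceMatrix f) ''
      {f : V → ℝ | f ⬝ᵥ f = 1 ∧ (1 : V → ℝ) ⬝ᵥ f = 0} := by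
    ext q
    constructor
    · rintro ⟨f, h1, h2, h3⟩
      exact ⟨f, ⟨h1, h2⟩, h3.symm⟩
    · rintro ⟨f, ⟨h1, h2⟩, h3⟩
      exact ⟨f, h1, h2, h3.symm⟩
  have hclosed : IsClosed {f : V → ℝ | f ⬝ᵥ f = 1 ∧ (1 : V → ℝ) ⬝ᵥ f = 0} := by
    refine IsClosed.inter (isClosed_eq ?_ continuous_const) (isClosed_eq ?_ continuous_const)
    · exact Continuous.dotProduct continuous_id continuous_id
    · exact Continuous.dotProduct continuous_const continuous_id
  have hcompact : IsCompact {f : V → ℝ | f ⬝ᵥ f = 1 ∧ (1 : V → ℝ) ⬝ᵥ f = 0} := by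
    refine (isCompact_closedBall (0 : V → ℝ) 1).of_isClosed_subset hclosed ?_
    rintro f ⟨h1, -⟩
    rw [mem_closedBall_zero_iff, pi_norm_le_iff_of_nonneg zero_le_one]
    intro i
    have hi : f i * f i ≤ f ⬝ᵥ f :=
      Finset.single_le_sum (f := fun j => f j * f j) (fun j _ => mul_self_nonneg (f j))
        (Finset.mem_univ i)
    rw [Real.norm_eq_abs, abs_le]
    constructor <;> nlinarith
  have hne : {f : V → ℝ | f ⬝ᵥ f = 1 ∧ (1 : V → ℝ) ⬝ᵥ f = 0}.Nonempty := by
    obtain ⟨v, w, hvw⟩ := exists_pair_ne V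
    have h2 : (√2)⁻¹ * (√2)⁻¹ = (1 / 2 : ℝ) := by
      rw [← mul_inv, Real.mul_self_sqrt zero_le_two, one_div]
    refine ⟨Pi.single v (√2)⁻¹ - Pi.single w (√2)⁻¹, ?_, ?_⟩
    · simp only [sub_dotProduct, dotProduct_sub, single_dotProduct, Pi.single_eq_same,
        Pi.single_eq_of_ne hvw, Pi.single_eq_of_ne hvw.symm, mul_zero, h2]
      norm_num
    · simp [dotProduct_sub]
  have hcont : Continuous fun f : V → ℝ => f ⬝ᵥ Matrix.mulVec G.distanceMatrix f :=
    Continuous.dotProduct continuous_id (Continuous.matrix_mulVec continuous_const continuous_id)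
  unfold qec
  rw [himg]
  exact (hcompact.image hcont).isGreatest_sSup (hne.image _)

end SimpleGraph

namespace SimpleGraph

open Finset Matrix

/-! ### Distances in trees -/

section Dist

variable {V W : Type*} {G : SimpleGraph V} {H : SimpleGraph W}

/-! On vectors orthogonal to the constants, the Laplacian L of a tree satisfies L D f = -2 f. There
the form of D is that of -2 times the pseudoinverse of L, so QEC = -2/λ with λ the largest Laplacian
eigenvalue. For a tree, λ ≤ n with equality only for stars, λ ≥ deg v + 1 for every v, and λ < 4 for
paths. A tree that is not a path has a vertex of degree at least 3, hence λ ≥ 4.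

Eigenvectors are avoided: `IsTree.mul_dotProduct_lapMatrix_le` turns bounds on the Laplacian form
into bounds on QEC, and `IsTree.neg_two_div_degree_add_one_le_qec` uses a test vector. -/

theorem Connected.exists_adj_dist_add_one_eq (hG : G.Connected) {u v : V} (h : v ≠ u) :
    ∃ w, G.Adj v w ∧ G.dist w u + 1 = G.dist v u := by
  obtain ⟨p, hp⟩ := hG.exists_walk_length_eq_dist v u
  cases p with
  | nil => exact absurd rfl h
  | @cons _ w _ hadj q =>
    refine ⟨w, hadj, ?_⟩
    have h1 := G.dist_le q
    have h2 := hG.dist_triangle (u := v) (v := w) (w := u)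
    rw [dist_eq_one_iff_adj.mpr hadj] at h2
    rw [Walk.length_cons] at hp
    omega

/-- A closer neighbour is the second vertex of a path from `v` to `u`, and that path is unique. -/
theorem IsTree.eq_of_adj_of_dist_add_one_eq (hG : G.IsTree) {u v w w' : V}
    (hw : G.Adj v w) (hw' : G.Adj v w') (hd : G.dist w u + 1 = G.dist v u)
    (hd' : G.dist w' u + 1 = G.dist v u) : w = w' := by
  have key : ∀ x (hx : G.Adj v x), G.dist x u + 1 = G.dist v u →
      ∃ p : G.Walk v u, p.IsPath ∧ p.snd = x := by
    intro x hx hdx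
    obtain ⟨p, hp⟩ := hG.connected.exists_walk_length_eq_dist x u
    refine ⟨p.cons hx, Walk.isPath_of_length_eq_dist _ ?_, by simp⟩
    rw [Walk.length_cons, hp, hdx]
  obtain ⟨p, hp, rfl⟩ := key w hw hd
  obtain ⟨q, hq, rfl⟩ := key w' hw' hd'
  rw [(hG.existsUnique_path v u).unique hp hq]

theorem Connected.dist_map_le (hG : G.Connected) (f : G →g H) (u v : V) :
    H.dist (f u) (f v) ≤ G.dist u v := by
  obtain ⟨p, hp⟩ := hG.exists_walk_length_eq_dist u v
  rw [← hp, ← p.length_map f]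
  exact H.dist_le _

theorem Connected.dist_iso_apply (hG : G.Connected) (e : G ≃g H) (u v : V) :
    H.dist (e u) (e v) = G.dist u v := by
  refine le_antisymm (hG.dist_map_le e.toHom u v) ?_
  have h := (e.connected_iff.mp hG).dist_map_le e.symm.toHom (e u) (e v)
  simpa using h

theorem IsTree.adj_iff_dist_root {r : V} (hG : G.IsTree)
    (hinj : Function.Injective fun v => G.dist v r) {v w : V} :
    G.Adj v w ↔ G.dist v r + 1 = G.dist w r ∨ G.dist w r + 1 = G.dist v r := by
  have key : ∀ x y, G.dist x r + 1 = G.dist y r → G.Adj y x := by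
    intro x y h
    have hne : y ≠ r := by rintro rfl; simp at h
    obtain ⟨z, hz, hd⟩ := hG.connected.exists_adj_dist_add_one_eq hne
    have : z = x := hinj (by simp only; omega)
    exact this ▸ hz
  constructor
  · intro h
    have := hG.dist_eq_dist_add_one_of_adj r h
    rw [G.dist_comm (u := v), G.dist_comm (u := w)]
    omega
  · rintro (h | h)
    · exact (key _ _ h).symm
    · exact key _ _ h

end Dist

/-! ### Trees of maximum degree two are paths -/

section Iso

variable {V : Type*} [Fintype V] {G : SimpleGraph V} [DecidableRel G.Adj]

/-- Two vertices at the same distance have, by induction, a common predecessor `p`. If `p = r`, the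
leaf would have two neighbours; otherwise `p` also has its own predecessor, hence degree 3. -/
theorem IsTree.dist_leaf_injective (hG : G.IsTree) (hdeg : ∀ v, G.degree v ≤ 2) {r : V}
    (hr : G.degree r = 1) : Function.Injective fun v => G.dist v r := by
  classical
  have key : ∀ k v w, G.dist v r = k → G.dist w r = k → v = w := by
    intro k
    induction k with
    | zero =>
      intro v w hv hw
      rw [hG.connected.dist_eq_zero_iff] at hv hw
      rw [hv, hw]
    | succ k ih =>
      intro v w hv hw
      have hvr : v ≠ r := by rintro rfl; simp at hv
      have hwr : w ≠ r := by rintro rfl; simp at hw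
      obtain ⟨p, hp, hpd⟩ := hG.connected.exists_adj_dist_add_one_eq hvr
      obtain ⟨q, hq, hqd⟩ := hG.connected.exists_adj_dist_add_one_eq hwr
      obtain rfl : p = q := ih p q (by omega) (by omega)
      by_cases hpr : p = r
      · subst hpr
        exact (degree_eq_one_iff_existsUnique_adj.mp hr).unique hp.symm hq.symm
      · obtain ⟨s, hs, hsd⟩ := hG.connected.exists_adj_dist_add_one_eq hpr
        by_contra hvw
        have hsv : s ≠ v := by rintro rfl; omega
        have hsw : s ≠ w := by rintro rfl; omega
        have hsub : ({s, v, w} : Finset V) ⊆ G.neighborFinset p := by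
          intro x hx
          simp only [Finset.mem_insert, Finset.mem_singleton] at hx
          rw [mem_neighborFinset]
          rcases hx with rfl | rfl | rfl
          · exact hs
          · exact hp.symm
          · exact hq.symm
        have h3 := (Finset.card_le_card hsub).trans (hdeg p)
        rw [Finset.card_eq_three.mpr ⟨s, v, w, hsv, hsw, hvw, rfl⟩] at h3
        omega
  exact fun v w h => key _ v w rfl h.symm

theorem IsTree.nonempty_iso_pathGraph [Nontrivial V] (hG : G.IsTree)
    (hdeg : ∀ v, G.degree v ≤ 2) : Nonempty (G ≃g pathGraph (Fintype.card V)) := by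
  obtain ⟨r, hr⟩ := hG.exists_vert_degree_one_of_nontrivial
  have hinj := hG.dist_leaf_injective hdeg hr
  have hlt : ∀ v, G.dist v r < Fintype.card V := by
    intro v
    obtain ⟨p, hp, hl⟩ := hG.connected.exists_path_of_dist v r
    exact hl ▸ hp.length_lt
  let f : V → Fin (Fintype.card V) := fun v => ⟨G.dist v r, hlt v⟩
  have hf : Function.Bijective f := by
    rw [Fintype.bijective_iff_injective_and_card]
    exact ⟨fun v w h => hinj (by simpa [f] using h), by simp⟩
  refine ⟨⟨Equiv.ofBijective f hf, ?_⟩⟩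
  intro v w
  rw [pathGraph_adj, hG.adj_iff_dist_root hinj]
  rfl

theorem degree_le_two_of_le_pathGraph {n : ℕ} {G : SimpleGraph (Fin n)} [DecidableRel G.Adj]
    (h : G ≤ pathGraph n) (v : Fin n) : G.degree v ≤ 2 := by
  rw [← card_neighborFinset_eq_degree]
  -- At `v = 0` truncated subtraction only adds a spurious candidate, harmless for an upper bound.
  refine (Finset.card_le_card_of_injOn (t := {(v : ℕ) - 1, (v : ℕ) + 1}) Fin.val ?_
    Fin.val_injective.injOn).trans Finset.card_le_two
  intro w hw
  have hw : G.Adj v w := by simpa using hw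
  have := pathGraph_adj.mp (h hw)
  simp only [Finset.coe_insert, Finset.coe_singleton, Set.mem_insert_iff, Set.mem_singleton_iff]
  omega

/-- A spanning tree of the path has degrees at most two, so it is itself isomorphic to the path. -/
theorem isTree_pathGraph {n : ℕ} (hn : 2 ≤ n) : (pathGraph n).IsTree := by
  classical
  have : Nontrivial (Fin n) := Fin.nontrivial_iff_two_le.mpr hn
  have hc : (pathGraph n).Connected := ⟨pathGraph_preconnected n⟩
  obtain ⟨T, hle, hT⟩ := hc.exists_isTree_le
  obtain ⟨e⟩ := hT.nonempty_iso_pathGraph (degree_le_two_of_le_pathGraph hle)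
  rw [Fintype.card_fin] at e
  exact e.isTree_iff.mp hT

end Iso

/-! ### Stars -/

section Star

variable {V W : Type*} {G : SimpleGraph V}

theorem IsTree.eq_starGraph (hG : G.IsTree) {r : V} (hr : ∀ v, v ≠ r → G.Adj r v) :
    G = starGraph r := by
  ext x y
  rw [starGraph_adj]
  constructor
  · intro h
    refine ⟨h.ne, ?_⟩
    by_contra! hxy
    refine hG.dist_ne_of_adj r h ?_
    rw [dist_eq_one_iff_adj.mpr (hr x hxy.1), dist_eq_one_iff_adj.mpr (hr y hxy.2)]
  · rintro ⟨hne, rfl | rfl⟩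
    · exact hr y hne.symm
    · exact (hr x hne).symm

theorem completeBipartiteGraph_fin_one (W : Type*) :
    completeBipartiteGraph (Fin 1) W = starGraph (Sum.inl 0) := by
  ext x y
  rcases x with x | x <;> rcases y with y | y <;> simp [Subsingleton.elim _ (0 : Fin 1)]

theorem nonempty_iso_starGraph [Fintype V] [Fintype W]
    (h : Fintype.card V = Fintype.card W) (r : V) (s : W) :
    Nonempty (starGraph r ≃g starGraph s) := by
  classical
  let e := (Fintype.equivOfCardEq h).setValue r s
  have he : e r = s := Equiv.setValue_eq _ _ _
  refine ⟨⟨e, ?_⟩⟩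
  intro x y
  simp only [starGraph_adj, ← he, ne_eq, EmbeddingLike.apply_eq_iff_eq]

/-- In a tree no two pairs of vertices are completely joined to each other. -/
theorem IsTree.eq_or_eq_of_adj (hG : G.IsTree) {a a' b b' : V} (h1 : G.Adj a b)
    (h2 : G.Adj a b') (h3 : G.Adj a' b) (h4 : G.Adj a' b') : a = a' ∨ b = b' := by
  by_contra! h
  have hnadj : ¬ G.Adj a a' := by
    intro hadj
    refine hG.dist_ne_of_adj b hadj ?_
    rw [dist_eq_one_iff_adj.mpr h1.symm, dist_eq_one_iff_adj.mpr h3.symm]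
  have hlt := hG.connected.one_lt_dist_of_ne_of_not_adj h.1 hnadj
  have hle := hG.connected.dist_triangle (u := a) (v := b) (w := a')
  rw [dist_eq_one_iff_adj.mpr h1, dist_eq_one_iff_adj.mpr h3.symm] at hle
  refine h.2 (hG.eq_of_adj_of_dist_add_one_eq h1 h2 (u := a') ?_ ?_)
  · rw [dist_eq_one_iff_adj.mpr h3.symm]; omega
  · rw [dist_eq_one_iff_adj.mpr h4.symm]; omega

/-- Vertices with different values are adjacent, and a tree has no 4-cycle. So `a` is a centre
unless `b` is the only vertex whose value differs from `f a`, and then `b` is one. -/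
theorem IsTree.exists_forall_adj_of_not_adj_eq (hG : G.IsTree) {f : V → ℝ}
    (hf : ∀ v w, ¬ G.Adj v w → f v = f w) {a b : V} (hab : f a ≠ f b) :
    ∃ r, ∀ v, v ≠ r → G.Adj r v := by
  have hadj : ∀ {v w}, f v ≠ f w → G.Adj v w := fun h => not_not.mp fun h' => h (hf _ _ h')
  by_cases hb : ∃ b', b' ≠ b ∧ f b' ≠ f a
  · obtain ⟨b', hbb', hb'⟩ := hb
    refine ⟨a, fun v hv => ?_⟩
    by_cases h : f v = f a
    · rcases hG.eq_or_eq_of_adj (hadj hab) (hadj hb'.symm) (a' := v)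
        (hadj (h ▸ hab)) (hadj (h ▸ hb'.symm)) with h' | h'
      · exact absurd h'.symm hv
      · exact absurd h'.symm hbb'
    · exact hadj (Ne.symm h)
  · push Not at hb
    exact ⟨b, fun v hv => hadj (by rw [hb v hv]; exact hab.symm)⟩

end Star

/-! ### The Laplacian form and the distance matrix -/

section Laplacian

variable {V : Type*} [Fintype V] [DecidableEq V] (G : SimpleGraph V) [DecidableRel G.Adj]

theorem dotProduct_lapMatrix_mulVec_comm (x y : V → ℝ) :
    x ⬝ᵥ (G.lapMatrix ℝ *ᵥ y) = (G.lapMatrix ℝ *ᵥ x) ⬝ᵥ y := by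
  rw [dotProduct_mulVec, ← mulVec_transpose, (G.isSymm_lapMatrix (R := ℝ)).eq]

theorem one_dotProduct_lapMatrix_mulVec (x : V → ℝ) :
    (1 : V → ℝ) ⬝ᵥ (G.lapMatrix ℝ *ᵥ x) = 0 := by
  rw [dotProduct_lapMatrix_mulVec_comm]
  have : G.lapMatrix ℝ *ᵥ (1 : V → ℝ) = 0 := G.lapMatrix_mulVec_const_eq_zero
  rw [this, zero_dotProduct]

theorem dotProduct_lapMatrix_mulVec_self (x : V → ℝ) :
    x ⬝ᵥ (G.lapMatrix ℝ *ᵥ x) = (∑ i, ∑ j, if G.Adj i j then (x i - x j) ^ 2 else 0) / 2 := by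
  rw [← lapMatrix_toLinearMap₂', toLinearMap₂'_apply']

theorem dotProduct_lapMatrix_mulVec_self_nonneg (x : V → ℝ) :
    0 ≤ x ⬝ᵥ (G.lapMatrix ℝ *ᵥ x) := by
  rw [dotProduct_lapMatrix_mulVec_self]
  refine div_nonneg (Finset.sum_nonneg fun i _ => Finset.sum_nonneg fun j _ => ?_) zero_le_two
  split_ifs <;> positivity

/-- The right side is the Laplacian form of the complete graph, split into edges and non-edges. -/
theorem dotProduct_lapMatrix_mulVec_self_add_compl {x : V → ℝ} (hx : (1 : V → ℝ) ⬝ᵥ x = 0) :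
    x ⬝ᵥ (G.lapMatrix ℝ *ᵥ x) + (∑ i, ∑ j, if G.Adj i j then 0 else (x i - x j) ^ 2) / 2 =
      Fintype.card V * (x ⬝ᵥ x) := by
  have hs : ∑ i, x i = 0 := by simpa [dotProduct] using hx
  rw [dotProduct_lapMatrix_mulVec_self, ← add_div, ← Finset.sum_add_distrib]
  simp_rw [← Finset.sum_add_distrib]
  have : ∀ i j, ((if G.Adj i j then (x i - x j) ^ 2 else 0) +
      if G.Adj i j then 0 else (x i - x j) ^ 2) = x i * x i - 2 * x i * x j + x j * x j := by
    intro i j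
    split_ifs <;> ring
  simp_rw [this, Finset.sum_add_distrib, Finset.sum_sub_distrib, ← Finset.mul_sum, hs]
  simp only [dotProduct, Finset.sum_const, Finset.card_univ, nsmul_eq_mul, mul_zero,
    mul_left_comm _ (Fintype.card V : ℝ), ← Finset.mul_sum]
  ring

theorem dotProduct_lapMatrix_mulVec_self_add_signless (x : V → ℝ) :
    x ⬝ᵥ (G.lapMatrix ℝ *ᵥ x) + (∑ i, ∑ j, if G.Adj i j then (x i + x j) ^ 2 else 0) / 2 =
      ∑ i, 2 * G.degree i * x i ^ 2 := by
  rw [dotProduct_lapMatrix_mulVec_self, ← add_div, ← Finset.sum_add_distrib]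
  simp_rw [← Finset.sum_add_distrib]
  have h1 : ∀ i j, ((if G.Adj i j then (x i - x j) ^ 2 else 0) +
      if G.Adj i j then (x i + x j) ^ 2 else 0) =
      2 * ((if G.Adj i j then 1 else 0) * x i ^ 2) +
        2 * ((if G.Adj j i then 1 else 0) * x j ^ 2) := by
    intro i j
    simp only [G.adj_comm j i]
    split_ifs <;> ring
  simp_rw [h1, Finset.sum_add_distrib]
  rw [Finset.sum_comm (f := fun i j => 2 * ((if G.Adj j i then (1 : ℝ) else 0) * x j ^ 2))]
  simp_rw [← Finset.mul_sum, ← Finset.sum_mul, ← degree_eq_sum_if_adj, mul_assoc, ← Finset.mul_sum]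
  ring

theorem lapMatrix_mulVec_single_one_dotProduct_self (v : V) :
    (G.lapMatrix ℝ *ᵥ Pi.single v 1) ⬝ᵥ (G.lapMatrix ℝ *ᵥ Pi.single v 1) =
      G.degree v * (G.degree v + 1) := by
  have h : ∀ w, (G.lapMatrix ℝ *ᵥ Pi.single v 1) w * (G.lapMatrix ℝ *ᵥ Pi.single v 1) w =
      (if w = v then (G.degree v : ℝ) ^ 2 else 0) + if G.Adj v w then 1 else 0 := by
    intro w
    rw [mulVec_single_one, col_apply, lapMatrix, Matrix.sub_apply, degMatrix, diagonal_apply,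
      adjMatrix_apply]
    simp only [G.adj_comm w v]
    by_cases hw : w = v
    · subst hw; simp [sq]
    · by_cases hadj : G.Adj v w <;> simp [hw, hadj]
  rw [dotProduct, Finset.sum_congr rfl fun w _ => h w, Finset.sum_add_distrib,
    ← degree_eq_sum_if_adj]
  simp
  ring

variable {G}

/-- For `v ≠ w` exactly one neighbour of `v` is closer to `w` and the others are farther. These are
the entries of L D; the part independent of `w` vanishes on sum-zero vectors. -/
theorem IsTree.sum_neighborFinset_dist_sub (hG : G.IsTree) (v w : V) :
    ∑ u ∈ G.neighborFinset v, ((G.dist v w : ℝ) - G.dist u w) =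
      2 - G.degree v - if v = w then 2 else 0 := by
  by_cases hvw : v = w
  · subst hvw
    have : ∀ u ∈ G.neighborFinset v, ((G.dist v v : ℝ) - G.dist u v) = -1 := by
      intro u hu
      rw [mem_neighborFinset] at hu
      simp [dist_eq_one_iff_adj.mpr hu.symm]
    rw [Finset.sum_congr rfl this]
    simp
  · obtain ⟨p, hp, hpd⟩ := hG.connected.exists_adj_dist_add_one_eq hvw
    have : ∀ u ∈ G.neighborFinset v, ((G.dist v w : ℝ) - G.dist u w) =
        -1 + if u = p then 2 else 0 := by
      intro u hu
      rw [mem_neighborFinset] at hu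
      split_ifs with hup
      · subst hup
        rw [← hpd]; push_cast; ring
      · rcases hG.dist_eq_dist_add_one_of_adj w hu with h | h <;>
          rw [G.dist_comm (u := w), G.dist_comm (u := w)] at h
        · exact absurd (hG.eq_of_adj_of_dist_add_one_eq hu hp h.symm hpd) hup
        · rw [h]; push_cast; ring
    rw [Finset.sum_congr rfl this, Finset.sum_add_distrib, Finset.sum_ite_eq',
      if_pos (by simpa using hp)]
    simp [hvw]
    ring

/-- The Laplacian of a tree inverts the distance matrix on the orthogonal complement of the
constants, up to the factor `-2`. -/
theorem IsTree.lapMatrix_mulVec_distanceMatrix_mulVec (hG : G.IsTree) {f : V → ℝ}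
    (hf : (1 : V → ℝ) ⬝ᵥ f = 0) :
    G.lapMatrix ℝ *ᵥ (G.distanceMatrix *ᵥ f) = (-2 : ℝ) • f := by
  have hs : ∑ i, f i = 0 := by simpa [dotProduct] using hf
  ext v
  rw [lapMatrix_mulVec_apply]
  have h : (G.degree v : ℝ) * (G.distanceMatrix *ᵥ f) v -
      ∑ u ∈ G.neighborFinset v, (G.distanceMatrix *ᵥ f) u =
      ∑ w, (∑ u ∈ G.neighborFinset v, ((G.dist v w : ℝ) - G.dist u w)) * f w := by
    simp_rw [Finset.sum_mul]
    rw [Finset.sum_comm]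
    simp_rw [sub_mul, Finset.sum_sub_distrib]
    simp [mulVec, dotProduct, distanceMatrix]
  rw [h]
  simp_rw [hG.sum_neighborFinset_dist_sub, sub_mul, Finset.sum_sub_distrib, ← Finset.mul_sum, hs]
  simp

end Laplacian

/-! ### Bounds on the quadratic embedding constant -/

section QEC

variable {V : Type*} [Fintype V] {G : SimpleGraph V}

theorem qec_congr {W : Type*} [Fintype W] {H : SimpleGraph W} (hG : G.Connected) (e : G ≃g H) :
    G.qec = H.qec := by
  have key : ∀ f : W → ℝ, (f ∘ e) ⬝ᵥ (G.distanceMatrix *ᵥ (f ∘ e)) =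
      f ⬝ᵥ (H.distanceMatrix *ᵥ f) := by
    intro f
    refine Fintype.sum_equiv e.toEquiv _ _ fun v => ?_
    refine congrArg (f (e v) * ·) (Fintype.sum_equiv e.toEquiv _ _ fun w => ?_)
    simp [distanceMatrix, hG.dist_iso_apply e]
  have key1 : ∀ f g : W → ℝ, (f ∘ e) ⬝ᵥ (g ∘ e) = f ⬝ᵥ g := fun f g =>
    Fintype.sum_equiv e.toEquiv _ _ fun _ => rfl
  unfold qec
  congr 1
  ext q
  constructor
  · rintro ⟨f, h1, h2, rfl⟩
    obtain ⟨g, rfl⟩ : ∃ g : W → ℝ, g ∘ e = f := ⟨f ∘ e.symm, by ext; simp⟩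
    exact ⟨g, by rw [← key1, h1], by rw [← key1]; exact h2, key g⟩
  · rintro ⟨f, h1, h2, rfl⟩
    exact ⟨f ∘ e, by rw [key1, h1], by rw [← h2, ← key1]; rfl, (key f).symm⟩

theorem dotProduct_distanceMatrix_mulVec_le_qec_mul [Nontrivial V] (G : SimpleGraph V) {f : V → ℝ}
    (hf : (1 : V → ℝ) ⬝ᵥ f = 0) :
    f ⬝ᵥ (G.distanceMatrix *ᵥ f) ≤ G.qec * (f ⬝ᵥ f) := by
  have h0 : 0 ≤ f ⬝ᵥ f := Finset.sum_nonneg fun i _ => mul_self_nonneg (f i)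
  rcases h0.eq_or_lt with h | h
  · have : f = 0 := dotProduct_self_eq_zero.mp h.symm
    simp [this]
  · have hs : √(f ⬝ᵥ f) * √(f ⬝ᵥ f) = f ⬝ᵥ f := Real.mul_self_sqrt h0
    have hle : (√(f ⬝ᵥ f))⁻¹ * ((√(f ⬝ᵥ f))⁻¹ * (f ⬝ᵥ (G.distanceMatrix *ᵥ f))) ≤ G.qec := by
      refine G.isGreatest_qec.2 ⟨(√(f ⬝ᵥ f))⁻¹ • f, ?_, ?_, ?_⟩
      · rw [smul_dotProduct, dotProduct_smul, smul_eq_mul, smul_eq_mul, ← mul_assoc, ← mul_inv,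
          hs, inv_mul_cancel₀ h.ne']
      · rw [dotProduct_smul, hf, smul_zero]
      · rw [mulVec_smul, smul_dotProduct, dotProduct_smul, smul_eq_mul, smul_eq_mul]
    rwa [← mul_assoc, ← mul_inv, hs, inv_mul_le_iff₀ h, mul_comm] at hle

variable [DecidableEq V] [DecidableRel G.Adj]

/-- The test vector is the column f of L at `v`, with d = deg v: ⟨f, D f⟩ = -2 d and ⟨f, f⟩ = d (d +
1). -/
theorem IsTree.neg_two_div_degree_add_one_le_qec [Nontrivial V] (hG : G.IsTree) (v : V) :
    -2 / ((G.degree v : ℝ) + 1) ≤ G.qec := by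
  set f : V → ℝ := G.lapMatrix ℝ *ᵥ Pi.single v 1 with hf
  have h1 : (1 : V → ℝ) ⬝ᵥ f = 0 := G.one_dotProduct_lapMatrix_mulVec _
  have hle := dotProduct_distanceMatrix_mulVec_le_qec_mul G h1
  have hq : f ⬝ᵥ (G.distanceMatrix *ᵥ f) = -2 * G.degree v := by
    conv_lhs => rw [hf, ← dotProduct_lapMatrix_mulVec_comm, ← hf]
    rw [hG.lapMatrix_mulVec_distanceMatrix_mulVec h1, dotProduct_smul, single_one_dotProduct, hf,
      mulVec_single_one, col_apply, lapMatrix, Matrix.sub_apply, degMatrix, diagonal_apply_eq]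
    simp
  have hpos : (0 : ℝ) < G.degree v := by
    exact_mod_cast hG.preconnected.degree_pos_of_nontrivial v
  rw [hq, hf, lapMatrix_mulVec_single_one_dotProduct_self] at hle
  rw [div_le_iff₀ (by positivity)]
  refine le_of_mul_le_mul_left ?_ hpos
  linarith

/-- The Laplacian form is nonnegative at f + (c/2) D f. On an eigenvector of eigenvalue λ > 0 this
reads (λ - c)² ≥ 0. -/
theorem IsTree.mul_dotProduct_lapMatrix_le (hG : G.IsTree) {f : V → ℝ} (hf1 : f ⬝ᵥ f = 1)
    (hf : (1 : V → ℝ) ⬝ᵥ f = 0) (c : ℝ) :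
    c ^ 2 * (f ⬝ᵥ (G.distanceMatrix *ᵥ f)) ≤ 2 * (f ⬝ᵥ (G.lapMatrix ℝ *ᵥ f)) - 4 * c := by
  have h := G.dotProduct_lapMatrix_mulVec_self_nonneg (f + (c / 2) • (G.distanceMatrix *ᵥ f))
  have h2 := hG.lapMatrix_mulVec_distanceMatrix_mulVec hf
  have h3 : (G.distanceMatrix *ᵥ f) ⬝ᵥ (G.lapMatrix ℝ *ᵥ f) = -2 := by
    rw [dotProduct_lapMatrix_mulVec_comm, h2, smul_dotProduct, hf1]
    simp
  rw [mulVec_add, mulVec_smul, h2, add_dotProduct, dotProduct_add, dotProduct_add] at h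
  simp only [smul_dotProduct, dotProduct_smul, smul_eq_mul, hf1, h3] at h
  rw [dotProduct_comm (G.distanceMatrix *ᵥ f) f] at h
  nlinarith

theorem IsTree.qec_le [Nontrivial V] (hG : G.IsTree) {c : ℝ} (hc : 0 < c)
    (h : ∀ f : V → ℝ, f ⬝ᵥ f = 1 → (1 : V → ℝ) ⬝ᵥ f = 0 → f ⬝ᵥ (G.lapMatrix ℝ *ᵥ f) ≤ c) :
    G.qec ≤ -2 / c := by
  obtain ⟨f, h1, h2, h3⟩ := G.isGreatest_qec.1
  have := hG.mul_dotProduct_lapMatrix_le h1 h2 c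
  rw [h3, le_div_iff₀ hc]
  refine le_of_mul_le_mul_left ?_ hc
  linarith [h f h1 h2]

theorem IsTree.exists_le_dotProduct_lapMatrix [Nontrivial V] (hG : G.IsTree) {c : ℝ} (hc : 0 < c)
    (h : -2 / c ≤ G.qec) :
    ∃ f : V → ℝ, f ⬝ᵥ f = 1 ∧ (1 : V → ℝ) ⬝ᵥ f = 0 ∧ c ≤ f ⬝ᵥ (G.lapMatrix ℝ *ᵥ f) := by
  obtain ⟨f, h1, h2, h3⟩ := G.isGreatest_qec.1
  have := hG.mul_dotProduct_lapMatrix_le h1 h2 c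
  rw [h3, div_le_iff₀ hc] at h
  have := mul_le_mul_of_nonneg_left h hc.le
  exact ⟨f, h1, h2, by linarith⟩

theorem IsTree.qec_le_neg_two_div_card [Nontrivial V] (hG : G.IsTree) :
    G.qec ≤ -2 / (Fintype.card V : ℝ) := by
  refine hG.qec_le (by exact_mod_cast Fintype.card_pos) fun f h1 h2 => ?_
  have h := G.dotProduct_lapMatrix_mulVec_self_add_compl h2
  have h0 : (0 : ℝ) ≤ ∑ i, ∑ j, if G.Adj i j then 0 else (f i - f j) ^ 2 :=
    Finset.sum_nonneg fun i _ => Finset.sum_nonneg fun j _ => by split_ifs <;> positivity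
  rw [h1] at h
  linarith

theorem IsTree.exists_eq_starGraph_of_qec_eq [Nontrivial V] (hG : G.IsTree)
    (h : G.qec = -2 / (Fintype.card V : ℝ)) : ∃ r, G = starGraph r := by
  obtain ⟨f, h1, h2, h3⟩ := hG.exists_le_dotProduct_lapMatrix
    (by exact_mod_cast Fintype.card_pos) h.ge
  have hsum := G.dotProduct_lapMatrix_mulVec_self_add_compl h2
  rw [h1] at hsum
  have hnn : ∀ i j, (0 : ℝ) ≤ if G.Adj i j then 0 else (f i - f j) ^ 2 := by
    intro i j
    split_ifs <;> positivity
  -- The Laplacian form already reaches n, so nothing is left for the non-edges.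
  have h0 : ∑ i, ∑ j, (if G.Adj i j then 0 else (f i - f j) ^ 2) = 0 :=
    le_antisymm (by linarith) (Finset.sum_nonneg fun i _ => Finset.sum_nonneg fun j _ => hnn i j)
  have hf : ∀ v w, ¬ G.Adj v w → f v = f w := by
    intro v w hvw
    rw [Finset.sum_eq_zero_iff_of_nonneg fun i _ => Finset.sum_nonneg fun j _ => hnn i j] at h0
    have h0' := h0 v (Finset.mem_univ v)
    rw [Finset.sum_eq_zero_iff_of_nonneg fun j _ => hnn v j] at h0'
    have := h0' w (Finset.mem_univ w)
    rw [if_neg hvw, sq_eq_zero_iff] at this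
    linarith
  obtain ⟨a, b, hab⟩ : ∃ a b, f a ≠ f b := by
    by_contra! hcon
    obtain ⟨a, -⟩ := exists_pair_ne V
    have hfa : f = fun _ => f a := funext fun v => hcon v a
    have hz : f a = 0 := by
      rw [hfa] at h2
      simpa [dotProduct] using h2
    rw [hfa, hz] at h1
    simp [dotProduct] at h1
  obtain ⟨r, hr⟩ := hG.exists_forall_adj_of_not_adj_eq hf hab
  exact ⟨r, hG.eq_starGraph hr⟩

theorem qec_starGraph [Nontrivial V] (r : V) :
    (starGraph r).qec = -2 / (Fintype.card V : ℝ) := by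
  refine le_antisymm (isTree_starGraph r).qec_le_neg_two_div_card ?_
  have h := (isTree_starGraph r).neg_two_div_degree_add_one_le_qec r
  rw [degree_starGraph_center] at h
  have hc : ((Fintype.card V - 1 : ℕ) : ℝ) + 1 = Fintype.card V := by
    exact_mod_cast Nat.sub_add_cancel Fintype.card_pos
  rwa [hc] at h

/-- Otherwise some unit f has Laplacian form at least 4, the most that degrees ≤ 2 allow. Equality
makes f change sign along edges and vanish at a leaf, so f = 0 by connectedness. -/
theorem IsTree.qec_lt_of_degree_le_two [Nontrivial V] (hG : G.IsTree)
    (hdeg : ∀ v, G.degree v ≤ 2) : G.qec < -1 / 2 := by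
  by_contra! hcon
  obtain ⟨f, h1, -, h3⟩ := hG.exists_le_dotProduct_lapMatrix (c := 4) (by norm_num)
    (by norm_num at hcon ⊢; exact hcon)
  have hsum := G.dotProduct_lapMatrix_mulVec_self_add_signless f
  have hdeg' : ∀ i, (G.degree i : ℝ) ≤ 2 := fun i => by exact_mod_cast hdeg i
  have hd : ∀ i, 0 ≤ 4 * f i ^ 2 - 2 * G.degree i * f i ^ 2 := fun i => by
    nlinarith [hdeg' i, sq_nonneg (f i)]
  have hf4 : ∑ i, 4 * f i ^ 2 = 4 := by
    rw [← Finset.mul_sum]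
    simp only [dotProduct, ← sq] at h1
    rw [h1, mul_one]
  have hnn : ∀ i j, (0 : ℝ) ≤ if G.Adj i j then (f i + f j) ^ 2 else 0 := by
    intro i j
    split_ifs <;> positivity
  have hS : (0 : ℝ) ≤ ∑ i, ∑ j, if G.Adj i j then (f i + f j) ^ 2 else 0 :=
    Finset.sum_nonneg fun i _ => Finset.sum_nonneg fun j _ => hnn i j
  have hD : (0 : ℝ) ≤ ∑ i, (4 * f i ^ 2 - 2 * G.degree i * f i ^ 2) :=
    Finset.sum_nonneg fun i _ => hd i
  have hD' := hD
  rw [Finset.sum_sub_distrib, hf4] at hD'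
  have hD0 : ∑ i, (4 * f i ^ 2 - 2 * G.degree i * f i ^ 2) = 0 := by
    rw [Finset.sum_sub_distrib, hf4]
    linarith
  have hS0 : ∑ i, ∑ j, (if G.Adj i j then (f i + f j) ^ 2 else 0) = 0 := by linarith
  have hadj : ∀ i j, G.Adj i j → f j = -f i := by
    intro i j hij
    rw [Finset.sum_eq_zero_iff_of_nonneg fun i _ => Finset.sum_nonneg fun j _ => hnn i j] at hS0
    have h0 := hS0 i (Finset.mem_univ i)
    rw [Finset.sum_eq_zero_iff_of_nonneg fun j _ => hnn i j] at h0
    have := h0 j (Finset.mem_univ j)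
    rw [if_pos hij, sq_eq_zero_iff] at this
    linarith
  obtain ⟨r, hr⟩ := hG.exists_vert_degree_one_of_nontrivial
  have hfr : f r = 0 := by
    rw [Finset.sum_eq_zero_iff_of_nonneg fun i _ => hd i] at hD0
    have := hD0 r (Finset.mem_univ r)
    rw [hr] at this
    push_cast at this
    have : f r ^ 2 = 0 := by linarith
    exact pow_eq_zero_iff two_ne_zero |>.mp this
  have hf0 : f = 0 := by
    funext v
    obtain ⟨p⟩ := hG.preconnected v r
    induction p with
    | nil => exact hfr
    | cons h _ ih =>
      have h' := hadj _ _ h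
      rw [ih hr hfr] at h'
      simpa using h'.symm
  rw [hf0] at h1
  simp at h1

end QEC

end SimpleGraph

/-! ### The main theorem -/

open SimpleGraph in
theorem theorem1p2 {V : Type*} [Fintype V] (T : SimpleGraph V) (hT : T.IsTree)
    (n : ℕ) (hn : 4 ≤ n) (hV : Fintype.card V = n) :
    (SimpleGraph.pathGraph n).qec ≤ T.qec ∧
    T.qec ≤ (completeBipartiteGraph (Fin 1) (Fin (n - 1))).qec ∧
    (completeBipartiteGraph (Fin 1) (Fin (n - 1))).qec = -2 / (n : ℝ) ∧
    ((SimpleGraph.pathGraph n).qec = T.qec ↔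
      Nonempty (T ≃g SimpleGraph.pathGraph n)) ∧
    (T.qec = (completeBipartiteGraph (Fin 1) (Fin (n - 1))).qec ↔
      Nonempty (T ≃g completeBipartiteGraph (Fin 1) (Fin (n - 1)))) := by
  classical
  have : Nontrivial V := Fintype.one_lt_card_iff_nontrivial.mp (by omega)
  have : Nontrivial (Fin n) := Fin.nontrivial_iff_two_le.mpr (by omega)
  have hcard : Fintype.card V = Fintype.card (Fin 1 ⊕ Fin (n - 1)) := by
    simp only [Fintype.card_sum, Fintype.card_fin]
    omega
  have : Nontrivial (Fin 1 ⊕ Fin (n - 1)) :=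
    Fintype.one_lt_card_iff_nontrivial.mp (by omega)
  have hstar : (completeBipartiteGraph (Fin 1) (Fin (n - 1))).qec = -2 / (n : ℝ) := by
    rw [completeBipartiteGraph_fin_one, qec_starGraph, ← hcard, hV]
  have hpath : (pathGraph n).qec < -1 / 2 :=
    (isTree_pathGraph (by omega)).qec_lt_of_degree_le_two (degree_le_two_of_le_pathGraph le_rfl)
  have hiso : Nonempty (T ≃g pathGraph n) ∨ (pathGraph n).qec < T.qec := by
    by_cases hdeg : ∀ v, T.degree v ≤ 2
    · exact .inl (hV ▸ hT.nonempty_iso_pathGraph hdeg)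
    · push Not at hdeg
      obtain ⟨v, hv⟩ := hdeg
      -- Degree at least 3 gives QEC ≥ -2/(3 + 1) = -1/2, strictly above the path.
      refine .inr (hpath.trans_le (le_trans ?_ (hT.neg_two_div_degree_add_one_le_qec v)))
      have hv' : (3 : ℝ) ≤ T.degree v := by exact_mod_cast hv
      rw [div_le_div_iff₀ (by norm_num) (by linarith)]
      linarith
  refine ⟨?_, ?_, hstar, ⟨fun h => ?_, fun ⟨e⟩ => (qec_congr hT.connected e).symm⟩,
    ⟨fun h => ?_, fun ⟨e⟩ => qec_congr hT.connected e⟩⟩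
  · rcases hiso with ⟨⟨e⟩⟩ | h
    · exact (qec_congr hT.connected e).ge
    · exact h.le
  · rw [hstar, ← hV]
    exact hT.qec_le_neg_two_div_card
  · exact hiso.resolve_right h.not_lt
  · rw [hstar, ← hV] at h
    obtain ⟨r, rfl⟩ := hT.exists_eq_starGraph_of_qec_eq h
    rw [completeBipartiteGraph_fin_one]
    exact nonempty_iso_starGraph hcard r _
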